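/- Let $R=\bigoplus_{n\in\mathbb N}R_n$ be an $\mathbb N$-graded commutative ring that is a graded principal ideal domain, i.e. $R$ is an integral domain and every homogeneous ideal of $R$ is generated by a single element. Assume $R\neq R_0$, and let $M=\bigoplus_{n\in\mathbb N}M_n$ be a finitely generated $\mathbb N$-graded $R$-module. A graded elementary divisor decomposition of $M$ is an isomorphism of graded $R$-modules (an $R$-linear isomorphism preserving degrees in both directions) $$M\;\cong\;\bigoplus_{j=1}^{N}\Sigma^{n_j}R/(f_j)$$ with $N\in\mathbb N$, $n_1,\dots,n_N\in\mathbb N$, and homogeneous non-units $f_1,\dots,f_N\in R$ (zero is allowed) such that $f_j\mid f_{j+1}$ for all $1\le j<N$. Here $R/(f_j)$ is graded by the images of the $R_n$, $(\Sigma^mL)_n=L_{n-m}$ for $n\ge m$ and $(\Sigma^mL)_n=0$ for $n<m$, and direct sums are graded componentwise. The signature of such a decomposition is the multiset of the pairs $(n_j,R^\times\cdot f_j)$, $1\le j\le N$. Then $M$ admits a graded elementary divisor decomposition, and any two graded elementary divisor decompositions of $M$ have the same signature. -/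

import Mathlib

open scoped DirectSum

/-- An `ℕ`-graded commutative ring is a graded principal ideal domain if it is a domain and every
homogeneous ideal is generated by a single element. -/
structure IsGradedPID {R : Type*} [CommRing R] (𝒜 : ℕ → AddSubgroup R) [GradedRing 𝒜] : Prop where
  isDomain : IsDomain R
  principal : ∀ I : Ideal R, I.IsHomogeneous 𝒜 → I.IsPrincipal

/-- The grading of `Σ^m M`: the degree `n` part is `M_{n-m}` if `m ≤ n`, and `0` otherwise. -/
def shiftGrading {M : Type*} [AddCommGroup M] (m : ℕ) (𝓜 : ℕ → AddSubgroup M) :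
    ℕ → AddSubgroup M :=
  fun n => if m ≤ n then 𝓜 (n - m) else ⊥

/-- The grading of a quotient module `M ⧸ P`: the degree `n` part is the image of `M_n`. -/
def quotientGrading {R M : Type*} [CommRing R] [AddCommGroup M] [Module R M]
    (𝓜 : ℕ → AddSubgroup M) (P : Submodule R M) : ℕ → AddSubgroup (M ⧸ P) :=
  fun n => (𝓜 n).map P.mkQ.toAddMonoidHom

/-- The grading of a direct sum: the degree `n` part consists of the families all of whose
entries are homogeneous of degree `n`. -/
def directSumGrading {ι : Type*} {M : ι → Type*} [∀ i, AddCommGroup (M i)]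
    (𝓜 : ∀ i, ℕ → AddSubgroup (M i)) : ℕ → AddSubgroup (⨁ i, M i) :=
  fun n =>
    { carrier := {x | ∀ i, x i ∈ 𝓜 i n}
      zero_mem' := fun i => (𝓜 i n).zero_mem
      add_mem' := fun hx hy i => (𝓜 i n).add_mem (hx i) (hy i)
      neg_mem' := fun hx i => (𝓜 i n).neg_mem (hx i) }

/-- A graded elementary divisor decomposition of the graded module `(M, 𝓜)` over the graded ring
`(R, 𝒜)`: an isomorphism `M ≅ ⨁_j Σ^{n_j} R/(f_j)` of graded modules, with `f_j` homogeneous and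
not a unit, and `f_j ∣ f_{j+1}`. -/
structure GradedElementaryDivisorDecomposition {R M : Type*} [CommRing R] (𝒜 : ℕ → AddSubgroup R)
    [AddCommGroup M] [Module R M] (𝓜 : ℕ → AddSubgroup M) where
  /-- the number of summands -/
  N : ℕ
  /-- the shifts -/
  deg : Fin N → ℕ
  /-- the elementary divisors -/
  f : Fin N → R
  homogeneous : ∀ j, SetLike.IsHomogeneousElem 𝒜 (f j)
  not_isUnit : ∀ j, ¬ IsUnit (f j)
  dvd : ∀ (j : ℕ) (h : j + 1 < N), f ⟨j, Nat.lt_of_succ_lt h⟩ ∣ f ⟨j + 1, h⟩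
  /-- the underlying isomorphism of modules -/
  iso : M ≃ₗ[R] ⨁ j : Fin N, R ⧸ Ideal.span {f j}
  mem_iff : ∀ (n : ℕ) (x : M), iso x ∈ directSumGrading
    (fun j => shiftGrading (deg j) (quotientGrading 𝒜 (Ideal.span {f j}))) n ↔ x ∈ 𝓜 n

/-- The signature of a decomposition: the multiset of all pairs `(n_j, Rˣ · f_j)`. -/
def GradedElementaryDivisorDecomposition.signature {R M : Type*} [CommRing R]
    {𝒜 : ℕ → AddSubgroup R} [AddCommGroup M] [Module R M] {𝓜 : ℕ → AddSubgroup M}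
    (D : GradedElementaryDivisorDecomposition 𝒜 𝓜) : Multiset (ℕ × Set R) :=
  (Finset.univ : Finset (Fin D.N)).val.map fun j => (D.deg j, MulAction.orbit Rˣ (D.f j))

/-! ### Graded principal ideal domains with a nonzero part of positive degree -/

section GradedRing

variable {R : Type*} [CommRing R] (𝒜 : ℕ → AddSubgroup R) [GradedRing 𝒜]

/-! The irrelevant ideal is generated by one element `t`, necessarily homogeneous of positive
degree. It follows that `R₀` is a field and that every nonzero homogeneous element is a unit of `R₀`
times a power of `t` (`IsGradedUniformizer`): homogeneous elements are totally ordered by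
divisibility.

Existence: take homogeneous generators of `M`, as few as possible, with the tuple of their
`t`-torsion orders minimal. A homogeneous relation with a nonzero term could be divided by its
lowest power of `t`, giving a generator of smaller order (`exists_update`). So all relations are
diagonal, and sorting the generators by order gives the divisibility chain.

Uniqueness: for every decomposition, the number of `j` with `n_j = n` and `f_j ∤ t ^ a` is the
`R₀`-rank of the image of `t ^ a M_n` in `M / t ^ (a + 1) M`, which does not mention the
decomposition (`card_eq_powLayerRank`). Differences in `a` count the `f_j` associated to `t ^ (a +
1)`; the value for large `a` counts the zero `f_j`. -/

/-- In an `ℕ`-graded domain, the factors of a nonzero homogeneous element are homogeneous. -/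
theorem exists_mem_of_mul_mem [IsDomain R] {p q : R} {n : ℕ} (h : p * q ∈ 𝒜 n) (h0 : p * q ≠ 0) :
    ∃ i j, i + j = n ∧ p ∈ 𝒜 i ∧ q ∈ 𝒜 j := by
  classical
  -- Compare lowest and highest nonzero components. In a domain the extreme components of `p` and
  -- `q` multiply without cancellation, so both extreme degrees of `p * q` equal `n`; hence lowest
  -- and highest degree agree in each factor.
  have key : ∀ p : R, p ≠ 0 → ∃ i k, i ≤ k ∧ GradedRing.proj 𝒜 i p ≠ 0 ∧
      GradedRing.proj 𝒜 k p ≠ 0 ∧ (∀ j < i, GradedRing.proj 𝒜 j p = 0) ∧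
      (∀ j, k < j → GradedRing.proj 𝒜 j p = 0) := by
    intro p hp
    have hne : (DirectSum.decompose 𝒜 p).support.Nonempty := by
      rw [Finset.nonempty_iff_ne_empty]
      intro h
      apply hp
      rw [← DirectSum.sum_support_decompose 𝒜 p, h, Finset.sum_empty]
    refine ⟨_, _, Finset.min'_le_max' _ hne,
      (GradedRing.mem_support_iff 𝒜 p _).1 (Finset.min'_mem _ hne),
      (GradedRing.mem_support_iff 𝒜 p _).1 (Finset.max'_mem _ hne), fun j hj => ?_, fun j hj => ?_⟩
    · by_contra hc
      exact absurd (Finset.min'_le _ _ ((GradedRing.mem_support_iff 𝒜 p _).2 hc)) (not_le.2 hj)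
    · by_contra hc
      exact absurd (Finset.le_max' _ _ ((GradedRing.mem_support_iff 𝒜 p _).2 hc)) (not_le.2 hj)
  obtain ⟨i, k, hik, hi, hk, hlt, hgt⟩ := key p (left_ne_zero_of_mul h0)
  obtain ⟨i', k', hik', hi', hk', hlt', hgt'⟩ := key q (right_ne_zero_of_mul h0)
  have hmul : ∀ n, GradedRing.proj 𝒜 n (p * q) = ∑ ij ∈ Finset.HasAntidiagonal.antidiagonal n,
      GradedRing.proj 𝒜 ij.1 p * GradedRing.proj 𝒜 ij.2 q := by
    intro n
    simp only [GradedRing.proj_apply, DirectSum.decompose_mul]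
    exact DirectSum.coe_mul_apply_eq_sum_antidiagonal 𝒜 _ _ n
  have h1 : GradedRing.proj 𝒜 (i + i') (p * q) ≠ 0 := by
    rw [hmul, Finset.sum_eq_single (i, i')]
    · exact mul_ne_zero hi hi'
    · rintro ⟨a, b⟩ hab hne
      rw [Finset.HasAntidiagonal.mem_antidiagonal] at hab
      rcases lt_or_ge a i with h | h
      · simp [hlt a h]
      · rw [hlt' b (by simp at hab; by_contra hc; exact hne (by ext <;> simp <;> omega)), mul_zero]
    · simp
  have h2 : GradedRing.proj 𝒜 (k + k') (p * q) ≠ 0 := by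
    rw [hmul, Finset.sum_eq_single (k, k')]
    · exact mul_ne_zero hk hk'
    · rintro ⟨a, b⟩ hab hne
      rw [Finset.HasAntidiagonal.mem_antidiagonal] at hab
      rcases lt_or_ge k a with h | h
      · simp [hgt a h]
      · rw [hgt' b (by simp at hab; by_contra hc; exact hne (by ext <;> simp <;> omega)), mul_zero]
    · simp
  have e1 : i + i' = n := by
    by_contra hc
    exact h1 (DirectSum.decompose_of_mem_ne 𝒜 h (Ne.symm hc))
  have e2 : k + k' = n := by
    by_contra hc
    exact h2 (DirectSum.decompose_of_mem_ne 𝒜 h (Ne.symm hc))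
  have hom : ∀ (i : ℕ) (p : R), (∀ j < i, GradedRing.proj 𝒜 j p = 0) →
      (∀ j, i < j → GradedRing.proj 𝒜 j p = 0) → p ∈ 𝒜 i := by
    intro i p hl hg
    rw [← DirectSum.sum_support_decompose 𝒜 p]
    refine AddSubgroup.sum_mem _ fun j _ => ?_
    rcases lt_trichotomy j i with h | h | h
    · have := hl j h
      rw [GradedRing.proj_apply] at this
      rw [this]
      exact zero_mem _
    · subst h
      exact SetLike.coe_mem _
    · have := hg j h
      rw [GradedRing.proj_apply] at this
      rw [this]
      exact zero_mem _
  have hi_eq : i = k := by omega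
  have hi_eq' : i' = k' := by omega
  subst hi_eq hi_eq'
  exact ⟨i, i', e1, hom i p hlt hgt, hom i' q hlt' hgt'⟩

/-- The homogeneous element `t` of degree `d > 0` exhibits the domain `R` as the polynomial ring
in `t` over the field `R₀`. -/
structure IsGradedUniformizer (t : R) (d : ℕ) : Prop where
  isDomain : IsDomain R
  pos : 0 < d
  mem : t ∈ 𝒜 d
  ne_zero : t ≠ 0
  isUnit_of_mem : ∀ c ∈ 𝒜 0, c ≠ 0 → IsUnit c
  exists_eq : ∀ e, ∀ r ∈ 𝒜 e, r ≠ 0 → ∃ c ∈ 𝒜 0, IsUnit c ∧ ∃ b, e = d * b ∧ r = c * t ^ b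

variable {𝒜}

/-- Projection to degree `0` is a ring homomorphism for an `ℕ`-grading; it kills `t` and fixes `c`.
-/
theorem eq_zero_of_dvd_of_mem_zero {t c : R} {d : ℕ} (hd : 0 < d) (ht : t ∈ 𝒜 d)
    (hc : c ∈ 𝒜 0) (h : t ∣ c) : c = 0 := by
  obtain ⟨s, rfl⟩ := h
  have h0 : GradedRing.projZeroRingHom 𝒜 t = 0 :=
    DirectSum.decompose_of_mem_ne 𝒜 ht hd.ne'
  have h1 : GradedRing.projZeroRingHom 𝒜 (t * s) = t * s := DirectSum.decompose_of_mem_same 𝒜 hc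
  rw [← h1, map_mul, h0, zero_mul]

theorem IsGradedPID.exists_isGradedUniformizer (hR : IsGradedPID 𝒜) (hR₀ : 𝒜 0 ≠ ⊤) :
    ∃ t d, IsGradedUniformizer 𝒜 t d := by
  classical
  have := hR.isDomain
  obtain ⟨n, x, hn, hx, hx0⟩ : ∃ n x, 0 < n ∧ x ∈ 𝒜 n ∧ x ≠ 0 := by
    by_contra! hc
    apply hR₀
    rw [eq_top_iff]
    intro r _
    rw [← DirectSum.sum_support_decompose 𝒜 r]
    refine AddSubgroup.sum_mem _ fun j _ => ?_
    rcases Nat.eq_zero_or_pos j with rfl | hj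
    · exact SetLike.coe_mem _
    · rw [hc j _ hj (SetLike.coe_mem _)]
      exact zero_mem _
  obtain ⟨t, ht⟩ := (hR.principal _ (HomogeneousIdeal.irrelevant 𝒜).isHomogeneous).principal
  have hdvd : ∀ {n r}, 0 < n → r ∈ 𝒜 n → t ∣ r := by
    intro n r hn hr
    have : r ∈ (HomogeneousIdeal.irrelevant 𝒜).toIdeal :=
      HomogeneousIdeal.mem_irrelevant_of_mem 𝒜 hn hr
    rw [ht] at this
    exact Ideal.mem_span_singleton.1 this
  obtain ⟨s, rfl⟩ := hdvd hn hx
  obtain ⟨d, -, -, htd, -⟩ := exists_mem_of_mul_mem 𝒜 hx hx0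
  have ht0 : t ≠ 0 := left_ne_zero_of_mul hx0
  have hd : 0 < d := by
    rw [pos_iff_ne_zero]
    rintro rfl
    have h1 : t ∈ (HomogeneousIdeal.irrelevant 𝒜).toIdeal := by
      rw [ht]
      exact Ideal.mem_span_singleton_self t
    have h2 : GradedRing.proj 𝒜 0 t = 0 := (HomogeneousIdeal.mem_irrelevant_iff 𝒜 t).1 h1
    rw [GradedRing.proj_apply, DirectSum.decompose_of_mem_same 𝒜 htd] at h2
    exact ht0 h2
  have hunit : ∀ c ∈ 𝒜 0, c ≠ 0 → IsUnit c := by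
    intro c hc hc0
    have hI : (Ideal.span {c, t}).IsHomogeneous 𝒜 := by
      apply Ideal.homogeneous_span
      rintro y (rfl | rfl)
      exacts [⟨0, hc⟩, ⟨d, htd⟩]
    obtain ⟨p, hp⟩ : ∃ p, Ideal.span {c, t} = Ideal.span {p} := (hR.principal _ hI).principal
    have hpc : p ∣ c := Ideal.mem_span_singleton.1 (show c ∈ Ideal.span {p} from
      hp ▸ Ideal.subset_span (by simp))
    have hpt : p ∣ t := Ideal.mem_span_singleton.1 (show t ∈ Ideal.span {p} from
      hp ▸ Ideal.subset_span (by simp))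
    obtain ⟨q, rfl⟩ := hpc
    obtain ⟨i, j, hij, hpi, -⟩ := exists_mem_of_mul_mem 𝒜 hc hc0
    obtain rfl : i = 0 := by omega
    obtain ⟨q', hq'⟩ := hpt
    obtain ⟨i', j', hij', hpi', hq''⟩ := exists_mem_of_mul_mem 𝒜 (hq' ▸ htd) (hq' ▸ ht0)
    have hp0 : p ≠ 0 := left_ne_zero_of_mul hc0
    obtain rfl : 0 = i' := DirectSum.degree_eq_of_mem_mem 𝒜 hpi hpi' hp0
    obtain ⟨s', hs'⟩ := hdvd (by omega) hq''
    -- Since `p` has degree `0`, the cofactor `q'` has degree `d > 0` and is itself a multiple of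
    -- `t`; cancelling `t` in `t = p * (t * s')` inverts `p`.
    have hpu : IsUnit p := by
      refine IsUnit.of_mul_eq_one s' (mul_left_cancel₀ ht0 ?_)
      rw [mul_one]
      conv_rhs => rw [hq', hs']
      ring
    have h1 : (1 : R) ∈ Ideal.span {p * q, t} := by
      rw [hp]
      exact Ideal.mem_span_singleton.2 hpu.dvd
    obtain ⟨a, b, hab⟩ := Ideal.mem_span_pair.1 h1
    -- In degree `0` the multiple of `t` disappears, and the projection of `a` becomes an inverse of
    -- `p * q`.
    have h2 := congrArg (GradedRing.projZeroRingHom 𝒜) hab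
    rw [map_add, map_mul, map_mul _ b, map_one,
      show GradedRing.projZeroRingHom 𝒜 t = 0 from DirectSum.decompose_of_mem_ne 𝒜 htd hd.ne',
      show GradedRing.projZeroRingHom 𝒜 (p * q) = p * q from
        DirectSum.decompose_of_mem_same 𝒜 hc, mul_zero, add_zero, mul_comm] at h2
    exact IsUnit.of_mul_eq_one _ h2
  refine ⟨t, d, this, hd, htd, ht0, hunit, fun e => ?_⟩
  induction e using Nat.strong_induction_on with
  | _ e ih =>
    intro r hr hr0
    rcases Nat.eq_zero_or_pos e with rfl | he
    · exact ⟨r, hr, hunit r hr hr0, 0, by simp⟩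
    · obtain ⟨s', rfl⟩ := hdvd he hr
      obtain ⟨i, j, hij, hti, hs'⟩ := exists_mem_of_mul_mem 𝒜 hr hr0
      obtain rfl : d = i := DirectSum.degree_eq_of_mem_mem 𝒜 htd hti ht0
      obtain ⟨c, hc, hcu, b, hb, rfl⟩ := ih j (by omega) s' hs' (right_ne_zero_of_mul hr0)
      exact ⟨c, hc, hcu, b + 1, by rw [← hij, hb]; ring, by ring⟩

namespace IsGradedUniformizer

variable {t : R} {d : ℕ}

theorem pow_mem (ht : IsGradedUniformizer 𝒜 t d) (b : ℕ) : t ^ b ∈ 𝒜 (d * b) := by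
  have := SetLike.pow_mem_graded b ht.mem
  rwa [smul_eq_mul, mul_comm] at this

theorem not_isUnit (ht : IsGradedUniformizer 𝒜 t d) : ¬ IsUnit t := by
  have := ht.isDomain
  intro h
  exact one_ne_zero (eq_zero_of_dvd_of_mem_zero ht.pos ht.mem (SetLike.GradedOne.one_mem (A := 𝒜))
    h.dvd)

omit [GradedRing 𝒜] in
theorem pow_dvd_of_not_dvd_pow (ht : IsGradedUniformizer 𝒜 t d) {f : R}
    (hf : SetLike.IsHomogeneousElem 𝒜 f) {a : ℕ} (h : ¬ f ∣ t ^ a) : t ^ (a + 1) ∣ f := by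
  obtain ⟨e, he⟩ := hf
  by_cases hf0 : f = 0
  · simp [hf0]
  obtain ⟨c, -, hcu, b, -, rfl⟩ := ht.exists_eq e f he hf0
  rw [hcu.mul_left_dvd] at h
  refine Dvd.dvd.mul_left (pow_dvd_pow t ?_) c
  by_contra hlt
  exact h (pow_dvd_pow t (by omega))

end IsGradedUniformizer

end GradedRing

/-! ### Homogeneous components and homogeneous generators -/

section GradedModule

variable {M : Type*} [AddCommGroup M] (𝓜 : ℕ → AddSubgroup M) [DirectSum.Decomposition 𝓜]

/-- The projection of a graded group onto its degree `n` part. -/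
def gradedComponent (n : ℕ) : M →+ M where
  toFun x := DirectSum.decompose 𝓜 x n
  map_zero' := by simp
  map_add' x y := by simp

theorem gradedComponent_mem (n : ℕ) (x : M) : gradedComponent 𝓜 n x ∈ 𝓜 n :=
  SetLike.coe_mem _

theorem gradedComponent_of_mem {n : ℕ} {x : M} (hx : x ∈ 𝓜 n) : gradedComponent 𝓜 n x = x :=
  DirectSum.decompose_of_mem_same 𝓜 hx

theorem gradedComponent_of_mem_ne {n m : ℕ} {x : M} (hx : x ∈ 𝓜 m) (h : m ≠ n) :
    gradedComponent 𝓜 n x = 0 :=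
  DirectSum.decompose_of_mem_ne 𝓜 hx h

theorem exists_eq_sum_gradedComponent (x : M) :
    ∃ s : Finset ℕ, x = ∑ n ∈ s, gradedComponent 𝓜 n x := by
  classical
  exact ⟨_, (DirectSum.sum_support_decompose 𝓜 x).symm⟩

variable {R : Type*} [CommRing R] (𝒜 : ℕ → AddSubgroup R) [GradedRing 𝒜] [Module R M]
  [SetLike.GradedSMul 𝒜 𝓜]

/-- This splits a relation among homogeneous elements into homogeneous relations, degree by degree.
-/
theorem gradedComponent_smul_of_mem {m : ℕ} {x : M} (hx : x ∈ 𝓜 m) (r : R) (n : ℕ) :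
    gradedComponent 𝓜 n (r • x) = if m ≤ n then gradedComponent 𝒜 (n - m) r • x else 0 := by
  classical
  obtain ⟨s, hs⟩ := exists_eq_sum_gradedComponent 𝒜 r
  have hmem : ∀ k, gradedComponent 𝒜 k r • x ∈ 𝓜 (k + m) := fun k =>
    SetLike.GradedSMul.smul_mem (gradedComponent_mem 𝒜 k r) hx
  have h0 : ∀ k ∉ s, gradedComponent 𝒜 k r = 0 := by
    intro k hk
    rw [hs, map_sum]
    refine Finset.sum_eq_zero fun j hj => ?_
    refine gradedComponent_of_mem_ne 𝒜 (gradedComponent_mem 𝒜 j r) ?_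
    rintro rfl
    exact hk hj
  conv_lhs => rw [hs, Finset.sum_smul, map_sum]
  split_ifs with hmn
  · rw [Finset.sum_eq_single (n - m)]
    · apply gradedComponent_of_mem
      have := hmem (n - m)
      rwa [Nat.sub_add_cancel hmn] at this
    · intro k _ hk
      exact gradedComponent_of_mem_ne 𝓜 (hmem k) (by omega)
    · intro h
      rw [h0 _ h, zero_smul, map_zero]
  · refine Finset.sum_eq_zero fun k _ => ?_
    exact gradedComponent_of_mem_ne 𝓜 (hmem k) (by omega)

/-- A finitely generated graded module has a finite family of homogeneous generators. -/
theorem exists_homogeneous_generators [Module.Finite R M] :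
    ∃ (N : ℕ) (x : Fin N → M), (∀ j, SetLike.IsHomogeneousElem 𝓜 (x j)) ∧
      Submodule.span R (Set.range x) = ⊤ := by
  classical
  obtain ⟨S, hS⟩ := Module.Finite.fg_top (R := R) (M := M)
  choose s hs using exists_eq_sum_gradedComponent 𝓜
  let T : Finset M := S.biUnion fun x => (s x).image fun n => gradedComponent 𝓜 n x
  refine ⟨T.card, fun j => T.equivFin.symm j, fun j => ?_, ?_⟩
  · obtain ⟨x, -, h⟩ := Finset.mem_biUnion.1 (T.equivFin.symm j).2
    obtain ⟨n, -, h⟩ := Finset.mem_image.1 h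
    refine ⟨n, ?_⟩
    change (T.equivFin.symm j : M) ∈ 𝓜 n
    rw [← h]
    exact gradedComponent_mem 𝓜 n x
  · rw [eq_top_iff, ← hS, Submodule.span_le]
    intro x hx
    rw [hs x]
    refine Submodule.sum_mem _ fun n hn => Submodule.subset_span ?_
    have : gradedComponent 𝓜 n x ∈ T :=
      Finset.mem_biUnion.2 ⟨x, hx, Finset.mem_image_of_mem _ hn⟩
    exact ⟨T.equivFin ⟨_, this⟩, by simp⟩

end GradedModule

/-! ### Torsion orders with respect to powers of one element -/

section TorsionOrder

variable {R M : Type*} [CommRing R] [AddCommGroup M] [Module R M]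

/-- The least `n` with `t ^ n • x = 0`, or `⊤` if there is none. -/
noncomputable def powTorsionOrder (t : R) (x : M) : ℕ∞ :=
  ⨅ (n : ℕ) (_ : t ^ n • x = 0), (n : ℕ∞)

theorem powTorsionOrder_le_iff {t : R} {x : M} {n : ℕ} :
    powTorsionOrder t x ≤ n ↔ t ^ n • x = 0 := by
  refine ⟨fun h => ?_, fun h => iInf₂_le n h⟩
  by_contra hn
  have : ((n + 1 : ℕ) : ℕ∞) ≤ powTorsionOrder t x := by
    refine le_iInf₂ fun m hm => ?_
    rw [Nat.cast_le]
    by_contra hlt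
    apply hn
    obtain ⟨k, hk⟩ := Nat.exists_eq_add_of_le (show m ≤ n by omega)
    rw [hk, add_comm, pow_add, mul_smul, hm, smul_zero]
  have := this.trans h
  rw [Nat.cast_le] at this
  omega

/-- The element `t ^ a`, to be read as `0` for `a = ⊤`. -/
def enatPow (t : R) (a : ℕ∞) : R :=
  a.recTopCoe 0 (fun n => t ^ n)

@[simp] theorem enatPow_top (t : R) : enatPow t ⊤ = 0 := rfl

@[simp] theorem enatPow_coe (t : R) (n : ℕ) : enatPow t n = t ^ n := rfl

theorem enatPow_dvd_enatPow (t : R) {a b : ℕ∞} (h : a ≤ b) : enatPow t a ∣ enatPow t b := by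
  induction b using ENat.recTopCoe with
  | top => simp
  | coe b =>
    obtain ⟨a, rfl⟩ := ENat.ne_top_iff_exists.1 (ne_top_of_le_ne_top (ENat.natCast_ne_top b) h)
    exact pow_dvd_pow t (Nat.cast_le.1 h)

theorem enatPow_powTorsionOrder_smul (t : R) (x : M) : enatPow t (powTorsionOrder t x) • x = 0 := by
  induction h : powTorsionOrder t x using ENat.recTopCoe with
  | top => simp
  | coe n => exact powTorsionOrder_le_iff.1 h.le

theorem enatPow_dvd_pow_of_smul_eq_zero {t : R} {x : M} {n : ℕ} (h : t ^ n • x = 0) :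
    enatPow t (powTorsionOrder t x) ∣ t ^ n :=
  enatPow_dvd_enatPow t (powTorsionOrder_le_iff.2 h)

end TorsionOrder

/-! ### Generators with only diagonal relations -/

section Existence

variable {R : Type*} [CommRing R] {𝒜 : ℕ → AddSubgroup R} [GradedRing 𝒜] {t : R} {d : ℕ}
  {M : Type*} [AddCommGroup M] [Module R M]
  {𝓜 : ℕ → AddSubgroup M} [DirectSum.Decomposition 𝓜] [SetLike.GradedSMul 𝒜 𝓜]

theorem IsGradedUniformizer.homogeneous_enatPow (ht : IsGradedUniformizer 𝒜 t d) (a : ℕ∞) :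
    SetLike.IsHomogeneousElem 𝒜 (enatPow t a) := by
  induction a using ENat.recTopCoe with
  | top => exact ⟨0, zero_mem _⟩
  | coe a => exact ⟨_, ht.pow_mem a⟩

omit [DirectSum.Decomposition 𝓜] in
/-- A homogeneous generator occurring in a homogeneous relation with a nonzero term can be
replaced by one of smaller order. -/
theorem IsGradedUniformizer.exists_update (ht : IsGradedUniformizer 𝒜 t d) {ι : Type*} [Fintype ι]
    [DecidableEq ι] {x : ι → M} {deg : ι → ℕ} (hx : ∀ j, x j ∈ 𝓜 (deg j))
    (hspan : Submodule.span R (Set.range x) = ⊤) {r : ι → R} {e : ℕ}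
    (hr : ∀ j, r j ≠ 0 → ∃ k, k + deg j = e ∧ r j ∈ 𝒜 k)
    (hsum : ∑ j, r j • x j = 0) {j₀ : ι} (hj₀ : r j₀ • x j₀ ≠ 0) :
    ∃ i, ∃ y ∈ 𝓜 (deg i), Submodule.span R (Set.range (Function.update x i y)) = ⊤ ∧
      powTorsionOrder t y < powTorsionOrder t (x i) := by
  classical
  let J : Finset ι := Finset.univ.filter fun j => r j • x j ≠ 0
  -- The condition `j ∈ J` sits inside the existentials so that `c` and `b` become total functions;
  -- their values off `J` are dummies.
  have hrJ : ∀ j, ∃ c ∈ 𝒜 0, ∃ b, j ∈ J → IsUnit c ∧ d * b + deg j = e ∧ r j = c * t ^ b := by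
    intro j
    by_cases hj : j ∈ J
    · have h0 : r j ≠ 0 := fun h => (Finset.mem_filter.1 hj).2 (by rw [h, zero_smul])
      obtain ⟨k, hk, hrk⟩ := hr j h0
      obtain ⟨c, hc, hcu, b, hb, h⟩ := ht.exists_eq k _ hrk h0
      exact ⟨c, hc, b, fun _ => ⟨hcu, hb ▸ hk, h⟩⟩
    · exact ⟨0, zero_mem _, 0, fun h => absurd h hj⟩
  choose c hc b hb using hrJ
  obtain ⟨i, hi, hmin⟩ := J.exists_min_image b ⟨j₀, Finset.mem_filter.2 ⟨Finset.mem_univ _, hj₀⟩⟩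
  -- This is the relation divided by its lowest power `t ^ b i`. The coefficient of `x i` is the
  -- unit `c i`, so `y` can replace `x i`; and `t ^ b i` kills `y` but not `x i`.
  let y : M := ∑ j ∈ J, (c j * t ^ (b j - b i)) • x j
  have hy : t ^ b i • y = 0 := by
    rw [Finset.smul_sum, ← hsum, ← Finset.sum_filter_ne_zero Finset.univ]
    refine Finset.sum_congr rfl fun j hj => ?_
    rw [(hb j hj).2.2, ← mul_smul]
    congr 1
    rw [mul_left_comm, ← pow_add, Nat.add_sub_cancel' (hmin j hj)]
  refine ⟨i, y, ?_, ?_, ?_⟩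
  · refine AddSubgroup.sum_mem _ fun j hj => ?_
    have h1 := SetLike.GradedMul.mul_mem (hc j) (ht.pow_mem (b j - b i))
    have h2 : _ ∈ 𝓜 _ := SetLike.GradedSMul.smul_mem h1 (hx j)
    have h3 : 0 + d * (b j - b i) + deg j = deg i := by
      have e1 := (hb j hj).2.1
      have e2 := (hb i hi).2.1
      have e3 : d * b j = d * (b j - b i) + d * b i := by
        rw [← mul_add, Nat.sub_add_cancel (hmin j hj)]
      omega
    rw [vadd_eq_add, h3] at h2
    exact h2
  · have hmem : ∀ j, j ≠ i → x j ∈ Submodule.span R (Set.range (Function.update x i y)) :=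
      fun j hj => Submodule.subset_span ⟨j, Function.update_of_ne hj _ _⟩
    have hymem : y ∈ Submodule.span R (Set.range (Function.update x i y)) :=
      Submodule.subset_span ⟨i, Function.update_self _ _ _⟩
    have hxi : c i • x i = y - ∑ j ∈ J.erase i, (c j * t ^ (b j - b i)) • x j := by
      rw [eq_sub_iff_add_eq, show y = _ from (Finset.add_sum_erase J _ hi).symm]
      simp
    rw [eq_top_iff, ← hspan, Submodule.span_le]
    rintro _ ⟨j, rfl⟩
    by_cases hj : j = i
    · subst hj
      rw [SetLike.mem_coe, ← Submodule.smul_mem_iff_of_isUnit _ (hb j hi).1, hxi]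
      exact sub_mem hymem (Submodule.sum_mem _ fun k hk =>
        Submodule.smul_mem _ _ (hmem k (Finset.ne_of_mem_erase hk)))
    · exact hmem j hj
  · refine (powTorsionOrder_le_iff.2 hy).trans_lt ?_
    rw [← not_le, powTorsionOrder_le_iff]
    intro h
    apply (Finset.mem_filter.1 hi).2
    rw [(hb i hi).2.2, mul_smul, h, smul_zero]

/-- Homogeneous generators of a graded module over `k[t]`, all of whose relations are
consequences of relations `t ^ a • x = 0`. -/
theorem IsGradedUniformizer.exists_diagonal_generators (ht : IsGradedUniformizer 𝒜 t d)
    [Module.Finite R M] :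
    ∃ (N : ℕ) (x : Fin N → M), (∀ j, SetLike.IsHomogeneousElem 𝓜 (x j)) ∧
      Submodule.span R (Set.range x) = ⊤ ∧ (∀ j, x j ≠ 0) ∧
      ∀ r : Fin N → R, ∑ j, r j • x j = 0 → ∀ j, enatPow t (powTorsionOrder t (x j)) ∣ r j := by
  classical
  have hex := exists_homogeneous_generators 𝓜 (R := R)
  obtain ⟨x₀, hx₀⟩ := Nat.find_spec hex
  have hNmin := fun n => Nat.find_min (m := n) hex
  generalize Nat.find hex = N at x₀ hx₀ hNmin
  let P : Set (Fin N → M) := {x | (∀ j, SetLike.IsHomogeneousElem 𝓜 (x j)) ∧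
      Submodule.span R (Set.range x) = ⊤}
  -- The product order on `Fin N → ℕ∞` is well-founded, and lowering one entry makes the tuple
  -- strictly smaller.
  obtain ⟨x, ⟨hxhom, hspan⟩, hmin⟩ := (InvImage.wf (fun (x : Fin N → M) j => powTorsionOrder t (x j))
    (wellFounded_lt (α := Fin N → ℕ∞))).has_min P ⟨x₀, hx₀⟩
  choose deg hx using hxhom
  have hdiag : ∀ (e : ℕ) (r : Fin N → R), (∀ j, r j ≠ 0 → ∃ k, k + deg j = e ∧ r j ∈ 𝒜 k) →
      ∑ j, r j • x j = 0 → ∀ j, r j • x j = 0 := by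
    intro e r hr hsum j₀
    by_contra hj₀
    obtain ⟨i, y, hy, hys, hlt⟩ := ht.exists_update hx hspan hr hsum hj₀
    refine hmin (Function.update x i y) ⟨fun j => ?_, hys⟩ ?_
    · by_cases h : j = i
      · subst h
        exact ⟨_, by rwa [Function.update_self]⟩
      · exact ⟨_, by rw [Function.update_of_ne h]; exact hx j⟩
    · have : (fun j => powTorsionOrder t (Function.update x i y j)) =
          Function.update (fun j => powTorsionOrder t (x j)) i (powTorsionOrder t y) := by
        ext1 j
        by_cases h : j = i
        · subst h; simp
        · simp [h]
      change (fun j => powTorsionOrder t (Function.update x i y j)) < _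
      rw [this]
      exact update_lt_self_iff.2 hlt
  refine ⟨N, x, fun j => ⟨_, hx j⟩, hspan, fun j hj => ?_, fun r hsum j => ?_⟩
  · cases N with
    | zero => exact j.elim0
    | succ N =>
      refine hNmin N (Nat.lt_succ_self N) ⟨fun k => x (j.succAbove k), fun k => ⟨_, hx _⟩, ?_⟩
      rw [eq_top_iff, ← hspan, Submodule.span_le]
      rintro _ ⟨k, rfl⟩
      rcases Fin.eq_self_or_eq_succAbove j k with rfl | ⟨k, rfl⟩
      · rw [hj]
        exact zero_mem _
      · exact Submodule.subset_span ⟨k, rfl⟩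
  · obtain ⟨s, hs⟩ := exists_eq_sum_gradedComponent 𝒜 (r j)
    rw [hs]
    refine Finset.dvd_sum fun m _ => ?_
    by_cases h0 : gradedComponent 𝒜 m (r j) = 0
    · rw [h0]
      exact dvd_zero _
    have h1 : gradedComponent 𝒜 m (r j) • x j = 0 := by
      -- In degree `m + deg j` the relation has as its `j`-th coefficient exactly the degree `m`
      -- component of `r j`.
      have h2 := hdiag (m + deg j)
        (fun i => if deg i ≤ m + deg j then gradedComponent 𝒜 (m + deg j - deg i) (r i) else 0)
        (fun i hi => by
          split_ifs at hi ⊢ with hle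
          · exact ⟨_, Nat.sub_add_cancel hle, gradedComponent_mem _ _ _⟩
          · exact absurd rfl hi)
        (by
          have h3 := congrArg (gradedComponent 𝓜 (m + deg j)) hsum
          rw [map_sum, map_zero] at h3
          rw [← h3]
          refine Finset.sum_congr rfl fun i _ => ?_
          rw [gradedComponent_smul_of_mem 𝓜 𝒜 (hx i), ite_smul, zero_smul]) j
      simpa using h2
    obtain ⟨c, -, hcu, b, -, h⟩ := ht.exists_eq m _ (gradedComponent_mem 𝒜 m (r j)) h0
    rw [h] at h1 ⊢
    refine Dvd.dvd.mul_left (enatPow_dvd_pow_of_smul_eq_zero ?_) c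
    rwa [mul_smul, hcu.smul_eq_zero] at h1

end Existence

/-! ### Diagonal generators and decompositions -/

section Decomposition

variable {R : Type*} [CommRing R] {𝒜 : ℕ → AddSubgroup R} [GradedRing 𝒜]
  {M : Type*} [AddCommGroup M] [Module R M]
  {𝓜 : ℕ → AddSubgroup M} [DirectSum.Decomposition 𝓜] [SetLike.GradedSMul 𝒜 𝓜]

/-- The linear map `⨁ R/(f_j) → M` sending the generators to elements `x_j` killed by `f_j`. -/
def cyclicSumMap {N : ℕ} (f : Fin N → R) (x : Fin N → M) (hfx : ∀ j, f j • x j = 0) :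
    (⨁ j : Fin N, R ⧸ Ideal.span {f j}) →ₗ[R] M :=
  DirectSum.toModule R (Fin N) M fun j =>
    (Ideal.span {f j}).liftQ (LinearMap.toSpanSingleton R M (x j)) <| by
      rw [Ideal.span_le, Set.singleton_subset_iff]
      exact hfx j

theorem cyclicSumMap_apply {N : ℕ} (f : Fin N → R) (x : Fin N → M) (hfx : ∀ j, f j • x j = 0)
    (y : ⨁ j : Fin N, R ⧸ Ideal.span {f j}) (r : Fin N → R)
    (h : ∀ j, y j = Submodule.Quotient.mk (r j)) : cyclicSumMap f x hfx y = ∑ j, r j • x j := by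
  conv_lhs => rw [← DirectSum.sum_univ_of y, map_sum]
  refine Finset.sum_congr rfl fun j _ => ?_
  rw [h, ← DirectSum.lof_eq_of R, cyclicSumMap, DirectSum.toModule_lof]
  rfl

/-- Homogeneous generators with only diagonal relations, given by a divisibility chain, yield a
graded elementary divisor decomposition. -/
theorem nonempty_decomposition_of_generators {N : ℕ} {f : Fin N → R} {x : Fin N → M}
    {deg : Fin N → ℕ} (hf : ∀ j, SetLike.IsHomogeneousElem 𝒜 (f j)) (hfu : ∀ j, ¬ IsUnit (f j))
    (hdvd : ∀ i j, i ≤ j → f i ∣ f j) (hx : ∀ j, x j ∈ 𝓜 (deg j))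
    (hspan : Submodule.span R (Set.range x) = ⊤) (hfx : ∀ j, f j • x j = 0)
    (hrel : ∀ r : Fin N → R, ∑ j, r j • x j = 0 → ∀ j, f j ∣ r j) :
    Nonempty (GradedElementaryDivisorDecomposition 𝒜 𝓜) := by
  classical
  choose lift hlift using fun (j : Fin N) (q : R ⧸ Ideal.span {f j}) =>
    Submodule.Quotient.mk_surjective _ q
  have happ : ∀ y, cyclicSumMap f x hfx y = ∑ j, lift j (y j) • x j := fun y =>
    cyclicSumMap_apply f x hfx y _ fun j => (hlift j (y j)).symm
  have hinj : Function.Injective (cyclicSumMap f x hfx) := by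
    rw [injective_iff_map_eq_zero]
    intro y hy
    rw [happ] at hy
    refine DFinsupp.ext fun j => ?_
    rw [← hlift j (y j)]
    exact (Submodule.Quotient.mk_eq_zero _).2 (Ideal.mem_span_singleton.2 (hrel _ hy j))
  have hmk : ∀ r : Fin N → R, ∃ y : ⨁ j : Fin N, R ⧸ Ideal.span {f j},
      ∀ j, y j = Submodule.Quotient.mk (r j) := fun r =>
    ⟨DFinsupp.equivFunOnFintype.symm fun j => Submodule.Quotient.mk (r j), fun j => rfl⟩
  have hsurj : Function.Surjective (cyclicSumMap f x hfx) := by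
    intro m
    obtain ⟨r, rfl⟩ := (Submodule.mem_span_range_iff_exists_fun R).1
      (show m ∈ Submodule.span R (Set.range x) from hspan ▸ Submodule.mem_top)
    obtain ⟨y, hy⟩ := hmk r
    exact ⟨y, cyclicSumMap_apply f x hfx y r hy⟩
  have hmem : ∀ n y, y ∈ directSumGrading
      (fun j => shiftGrading (deg j) (quotientGrading 𝒜 (Ideal.span {f j}))) n ↔
      cyclicSumMap f x hfx y ∈ 𝓜 n := by
    intro n y
    constructor
    · intro hy
      have : ∀ j, ∃ r, y j = Submodule.Quotient.mk r ∧ r • x j ∈ 𝓜 n := by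
        intro j
        have hj : y j ∈ shiftGrading (deg j) (quotientGrading 𝒜 (Ideal.span {f j})) n := hy j
        unfold shiftGrading at hj
        split_ifs at hj with hle
        · obtain ⟨r, hr, hrj⟩ := hj
          refine ⟨r, hrj.symm, ?_⟩
          have h2 : r • x j ∈ 𝓜 _ := SetLike.GradedSMul.smul_mem hr (hx j)
          rwa [vadd_eq_add, Nat.sub_add_cancel hle] at h2
        · refine ⟨0, hj, ?_⟩
          rw [zero_smul]
          exact zero_mem _
      choose r hr hrx using this
      rw [cyclicSumMap_apply f x hfx y r hr]
      exact AddSubgroup.sum_mem _ fun j _ => hrx j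
    · intro hy
      -- Cut each lift down to the component that contributes to degree `n`. The image, already of
      -- degree `n`, does not change, so injectivity shows that `y` has homogeneous entries.
      obtain ⟨z, hz⟩ := hmk fun j =>
        if deg j ≤ n then gradedComponent 𝒜 (n - deg j) (lift j (y j)) else 0
      have hzy : z = y := by
        apply hinj
        rw [cyclicSumMap_apply f x hfx z _ hz, ← gradedComponent_of_mem 𝓜 hy, happ, map_sum]
        refine Finset.sum_congr rfl fun j _ => ?_
        rw [gradedComponent_smul_of_mem 𝓜 𝒜 (hx j), ite_smul, zero_smul]
      rw [← hzy]
      intro j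
      change z j ∈ shiftGrading (deg j) (quotientGrading 𝒜 (Ideal.span {f j})) n
      rw [hz]
      unfold shiftGrading
      split_ifs with hle
      · exact ⟨_, gradedComponent_mem 𝒜 _ _, rfl⟩
      · exact rfl
  let e := LinearEquiv.ofBijective (cyclicSumMap f x hfx) ⟨hinj, hsurj⟩
  exact ⟨{ N := N, deg := deg, f := f, homogeneous := hf, not_isUnit := hfu
           dvd := fun j h => hdvd _ _ (Nat.le_succ j)
           iso := e.symm
           mem_iff := fun n m => by
            rw [hmem]
            exact iff_of_eq (congrArg (· ∈ 𝓜 n) (e.apply_symm_apply m)) }⟩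

theorem IsGradedUniformizer.nonempty_decomposition {t : R} {d : ℕ}
    (ht : IsGradedUniformizer 𝒜 t d) [Module.Finite R M] :
    Nonempty (GradedElementaryDivisorDecomposition 𝒜 𝓜) := by
  have := ht.isDomain
  obtain ⟨N, x, hx, hspan, hx0, hrel⟩ := ht.exists_diagonal_generators (𝓜 := 𝓜)
  choose deg hx using hx
  -- Sorting by torsion order turns the divisors `t ^ a`, with `0` for infinite order last, into a
  -- divisibility chain.
  let σ := Tuple.sort fun j => powTorsionOrder t (x j)
  refine nonempty_decomposition_of_generators
    (f := fun j => enatPow t (powTorsionOrder t (x (σ j)))) (x := fun j => x (σ j))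
    (deg := fun j => deg (σ j))
    (fun j => ht.homogeneous_enatPow _) (fun j hu => ?_)
    (fun i j hij => enatPow_dvd_enatPow t
      (Tuple.monotone_sort (fun j => powTorsionOrder t (x j)) hij)) (fun j => hx _) ?_
    (fun j => enatPow_powTorsionOrder_smul _ _) (fun r hr j => ?_)
  · exact hx0 _ (hu.smul_eq_zero.1 (enatPow_powTorsionOrder_smul t (x (σ j))))
  · rw [← hspan]
    congr 1
    exact σ.surjective.range_comp x
  · have := hrel (fun j => r (σ.symm j)) (by
      rw [← hr, ← Equiv.sum_comp σ]
      simp) (σ j)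
    simpa using this

namespace GradedElementaryDivisorDecomposition

/-- The generators of the summands of a decomposition. -/
noncomputable def gen (D : GradedElementaryDivisorDecomposition 𝒜 𝓜) (j : Fin D.N) : M :=
  D.iso.symm (DirectSum.lof R (Fin D.N) (fun j => R ⧸ Ideal.span {D.f j}) j
    (Submodule.Quotient.mk 1))

variable (D : GradedElementaryDivisorDecomposition 𝒜 𝓜)

omit [DirectSum.Decomposition 𝓜] [SetLike.GradedSMul 𝒜 𝓜] in
theorem gen_mem (j : Fin D.N) : D.gen j ∈ 𝓜 (D.deg j) := by
  rw [← D.mem_iff, gen, LinearEquiv.apply_symm_apply]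
  intro i
  change _ ∈ shiftGrading (D.deg i) (quotientGrading 𝒜 (Ideal.span {D.f i})) (D.deg j)
  by_cases h : i = j
  · subst h
    rw [DirectSum.lof_apply]
    simp only [shiftGrading, le_refl, if_true, Nat.sub_self]
    exact ⟨1, SetLike.GradedOne.one_mem (A := 𝒜), rfl⟩
  · rw [DirectSum.lof_eq_of, DirectSum.of_eq_of_ne _ _ _ h]
    exact zero_mem _

omit [GradedRing 𝒜] [DirectSum.Decomposition 𝓜] [SetLike.GradedSMul 𝒜 𝓜] in
theorem iso_sum_smul_gen (r : Fin D.N → R) (j : Fin D.N) :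
    D.iso (∑ i, r i • D.gen i) j = Submodule.Quotient.mk (r j) := by
  rw [map_sum, DFinsupp.finsetSum_apply, Finset.sum_eq_single j]
  · rw [map_smul, gen, LinearEquiv.apply_symm_apply, DirectSum.smul_apply, DirectSum.lof_apply,
      ← Submodule.Quotient.mk_smul, smul_eq_mul, mul_one]
  · intro i _ hi
    rw [map_smul, gen, LinearEquiv.apply_symm_apply, DirectSum.smul_apply, DirectSum.lof_eq_of,
      DirectSum.of_eq_of_ne _ _ _ hi.symm, smul_zero]
  · simp

omit [GradedRing 𝒜] [DirectSum.Decomposition 𝓜] [SetLike.GradedSMul 𝒜 𝓜] in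
theorem sum_smul_gen_eq_zero_iff (r : Fin D.N → R) :
    ∑ i, r i • D.gen i = 0 ↔ ∀ j, D.f j ∣ r j := by
  rw [← D.iso.map_eq_zero_iff, DFinsupp.ext_iff]
  refine forall_congr' fun j => ?_
  change D.iso (∑ i, r i • D.gen i) j = 0 ↔ _
  rw [D.iso_sum_smul_gen, Submodule.Quotient.mk_eq_zero, Ideal.mem_span_singleton]

omit [GradedRing 𝒜] [DirectSum.Decomposition 𝓜] [SetLike.GradedSMul 𝒜 𝓜] in
theorem exists_eq_sum_smul_gen (x : M) : ∃ r : Fin D.N → R, x = ∑ i, r i • D.gen i := by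
  choose r hr using fun j => Submodule.Quotient.mk_surjective _ (D.iso x j)
  refine ⟨r, D.iso.injective (DFinsupp.ext fun j => ?_)⟩
  rw [← hr]
  exact (D.iso_sum_smul_gen r j).symm

omit [GradedRing 𝒜] [DirectSum.Decomposition 𝓜] [SetLike.GradedSMul 𝒜 𝓜] in
theorem f_smul_gen (j : Fin D.N) : D.f j • D.gen j = 0 := by
  have := (D.sum_smul_gen_eq_zero_iff (Pi.single j (D.f j))).2 fun i => by
    by_cases h : i = j
    · subst h; simp
    · simp [h]
  rwa [Finset.sum_eq_single j (fun i _ hi => by simp [hi]) (by simp), Pi.single_eq_same] at this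

end GradedElementaryDivisorDecomposition

end Decomposition

/-! ### Invariance of the signature -/

section Uniqueness

variable {R : Type*} [CommRing R] {𝒜 : ℕ → AddSubgroup R} [GradedRing 𝒜]
  {M : Type*} [AddCommGroup M] [Module R M]
  {𝓜 : ℕ → AddSubgroup M} [DirectSum.Decomposition 𝓜] [SetLike.GradedSMul 𝒜 𝓜]

variable (𝒜 𝓜) in
/-- The rank over `R₀` of the image of `t ^ a M_n` in `M / t ^ (a + 1) M`. -/
noncomputable def powLayerRank (t : R) (n a : ℕ) : ℕ :=
  Module.finrank (SetLike.GradeZero.subring 𝒜)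
    (Submodule.span (SetLike.GradeZero.subring 𝒜)
      ((fun x : M => (LinearMap.range (LinearMap.lsmul R M (t ^ (a + 1)))).mkQ (t ^ a • x)) ''
        (𝓜 n : Set M)))

namespace GradedElementaryDivisorDecomposition

variable (D : GradedElementaryDivisorDecomposition 𝒜 𝓜) {t : R} {d : ℕ}

omit [DirectSum.Decomposition 𝓜] [SetLike.GradedSMul 𝒜 𝓜] in
-- If a combination with coefficients `c j` in `R₀` lies in `t ^ (a + 1) M`, then modulo `t ^ (a +
-- 1)` each `f_j` divides `t ^ a * c j`. Here `f_j ∤ t ^ a` means `t ^ (a + 1) ∣ f_j`, so `t ∣ c j`,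
-- and `c j = 0` by degree.
theorem linearIndependent_pow_smul_gen (ht : IsGradedUniformizer 𝒜 t d) (n a : ℕ) :
    LinearIndependent (SetLike.GradeZero.subring 𝒜)
      (fun j : {j : Fin D.N // D.deg j = n ∧ ¬ D.f j ∣ t ^ a} =>
        (LinearMap.range (LinearMap.lsmul R M (t ^ (a + 1)))).mkQ (t ^ a • D.gen j)) := by
  classical
  have := ht.isDomain
  rw [Fintype.linearIndependent_iff]
  intro c hc j
  let r : Fin D.N → R := fun i => if h : D.deg i = n ∧ ¬ D.f i ∣ t ^ a then c ⟨i, h⟩ else 0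
  have hr : ∑ i, (t ^ a * r i) • D.gen i =
      ∑ i : {i : Fin D.N // D.deg i = n ∧ ¬ D.f i ∣ t ^ a}, (c i : R) • t ^ a • D.gen i := by
    have h1 := Finset.sum_subtype_of_mem (s := Finset.univ.filter
      fun i => D.deg i = n ∧ ¬ D.f i ∣ t ^ a) (p := fun i => D.deg i = n ∧ ¬ D.f i ∣ t ^ a)
      (fun i => (t ^ a * r i) • D.gen i) (fun i hi => (Finset.mem_filter.1 hi).2)
    rw [← Finset.sum_subset (Finset.subset_univ (Finset.univ.filter
      fun i => D.deg i = n ∧ ¬ D.f i ∣ t ^ a)), ← h1]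
    · refine Finset.sum_congr (by ext i; simpa [Finset.mem_subtype] using i.2) ?_
      intro i _
      simp only [r, dif_pos i.2, mul_comm (t ^ a), mul_smul]
    · intro i _ hi
      have : ¬ (D.deg i = n ∧ ¬ D.f i ∣ t ^ a) := fun h =>
        hi (Finset.mem_filter.2 ⟨Finset.mem_univ _, h⟩)
      simp only [r, dif_neg this, mul_zero, zero_smul]
  have hmem : ∑ i, (t ^ a * r i) • D.gen i ∈
      LinearMap.range (LinearMap.lsmul R M (t ^ (a + 1))) := by
    rw [← Submodule.Quotient.mk_eq_zero, ← Submodule.mkQ_apply, hr, map_sum, ← hc]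
    exact Finset.sum_congr rfl fun i _ => map_smul _ _ _
  obtain ⟨m, hm⟩ := hmem
  obtain ⟨s, rfl⟩ := D.exists_eq_sum_smul_gen m
  rw [LinearMap.lsmul_apply, Finset.smul_sum, eq_comm, ← sub_eq_zero, ← Finset.sum_sub_distrib]
    at hm
  have hdvd := (D.sum_smul_gen_eq_zero_iff fun i => t ^ a * r i - t ^ (a + 1) * s i).1
    (by rw [← hm]; exact Finset.sum_congr rfl fun i _ => by rw [sub_smul, mul_smul (t ^ (a + 1))]) j
  have h1 := (ht.pow_dvd_of_not_dvd_pow (D.homogeneous j) j.2.2).trans hdvd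
  rw [(dvd_sub_left (Dvd.intro _ rfl)), pow_succ] at h1
  have h2 : t ∣ r j := (mul_dvd_mul_iff_left (pow_ne_zero a ht.ne_zero)).1 h1
  have h3 : r j = c j := dif_pos j.2
  rw [h3] at h2
  exact Subtype.ext (eq_zero_of_dvd_of_mem_zero ht.pos ht.mem (c j).2 h2)

/-- Generators of degree below `n` enter with coefficients of positive degree, hence divisible by
`t`, and vanish modulo `t ^ (a + 1) M`. Those of degree `n` with `f_j ∣ t ^ a` are killed by `t ^
a`. -/
theorem span_range_pow_smul_gen (ht : IsGradedUniformizer 𝒜 t d) (n a : ℕ) :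
    Submodule.span (SetLike.GradeZero.subring 𝒜) (Set.range
      (fun j : {j : Fin D.N // D.deg j = n ∧ ¬ D.f j ∣ t ^ a} =>
        (LinearMap.range (LinearMap.lsmul R M (t ^ (a + 1)))).mkQ (t ^ a • D.gen j))) =
    Submodule.span (SetLike.GradeZero.subring 𝒜)
      ((fun x : M => (LinearMap.range (LinearMap.lsmul R M (t ^ (a + 1)))).mkQ (t ^ a • x)) ''
        (𝓜 n : Set M)) := by
  apply le_antisymm
  · refine Submodule.span_mono ?_
    rintro _ ⟨j, rfl⟩
    have h := D.gen_mem j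
    rw [j.2.1] at h
    exact ⟨D.gen j, h, rfl⟩
  · rw [Submodule.span_le]
    rintro _ ⟨x, hx, rfl⟩
    obtain ⟨r, hr⟩ := D.exists_eq_sum_smul_gen x
    have hx' : x = ∑ j, if D.deg j ≤ n then gradedComponent 𝒜 (n - D.deg j) (r j) • D.gen j
        else 0 := by
      rw [← gradedComponent_of_mem 𝓜 hx, hr, map_sum]
      exact Finset.sum_congr rfl fun j _ => gradedComponent_smul_of_mem 𝓜 𝒜 (D.gen_mem j) _ _
    rw [hx']
    simp only [Finset.smul_sum, map_sum]
    refine Submodule.sum_mem _ fun j _ => ?_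
    split_ifs with hle
    · rcases hle.eq_or_lt with heq | hlt
      · by_cases hdvd : D.f j ∣ t ^ a
        · obtain ⟨q, hq⟩ := hdvd
          rw [smul_comm, hq, mul_comm, mul_smul, D.f_smul_gen, smul_zero, smul_zero, map_zero]
          exact zero_mem _
        · rw [smul_comm, map_smul]
          have h0 : gradedComponent 𝒜 (n - D.deg j) (r j) ∈ 𝒜 0 := by
            have := gradedComponent_mem 𝒜 (n - D.deg j) (r j)
            rwa [heq, Nat.sub_self] at this ⊢
          exact Submodule.smul_mem _ (⟨_, h0⟩ : SetLike.GradeZero.subring 𝒜)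
            (Submodule.subset_span ⟨⟨j, heq, hdvd⟩, rfl⟩)
      · have h1 : t ∣ gradedComponent 𝒜 (n - D.deg j) (r j) := by
          by_cases h0 : gradedComponent 𝒜 (n - D.deg j) (r j) = 0
          · rw [h0]
            exact dvd_zero t
          · obtain ⟨c, -, -, b, hb, h⟩ := ht.exists_eq _ _ (gradedComponent_mem 𝒜 _ _) h0
            rw [h]
            refine Dvd.dvd.mul_left (dvd_pow_self t ?_) c
            rintro rfl
            omega
        obtain ⟨q, hq⟩ := h1
        have : (LinearMap.range (LinearMap.lsmul R M (t ^ (a + 1)))).mkQ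
            (t ^ a • gradedComponent 𝒜 (n - D.deg j) (r j) • D.gen j) = 0 := by
          rw [Submodule.mkQ_apply, Submodule.Quotient.mk_eq_zero]
          refine ⟨q • D.gen j, ?_⟩
          rw [hq, LinearMap.lsmul_apply, ← mul_smul, ← mul_smul]
          congr 1
          ring
        rw [this]
        exact zero_mem _
    · rw [smul_zero, map_zero]
      exact zero_mem _

open Classical in
theorem card_eq_powLayerRank (ht : IsGradedUniformizer 𝒜 t d) (n a : ℕ) :
    (Finset.univ.filter fun j => D.deg j = n ∧ ¬ D.f j ∣ t ^ a).card = powLayerRank 𝒜 𝓜 t n a := by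
  have := ht.isDomain
  rw [powLayerRank, ← D.span_range_pow_smul_gen ht n a,
    finrank_span_eq_card (D.linearIndependent_pow_smul_gen ht n a), Fintype.card_subtype]

open Classical in
omit [GradedRing 𝒜] [DirectSum.Decomposition 𝓜] [SetLike.GradedSMul 𝒜 𝓜] in
theorem count_signature (n : ℕ) (O : Set R) :
    D.signature.count (n, O) =
      (Finset.univ.filter fun j => D.deg j = n ∧ MulAction.orbit Rˣ (D.f j) = O).card := by
  rw [signature, Multiset.count_map, Finset.card_def, Finset.filter_val]
  congr 1
  refine Multiset.filter_congr fun j _ => ?_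
  rw [Prod.mk.injEq, eq_comm (a := n), eq_comm (a := O)]

omit [GradedRing 𝒜] [DirectSum.Decomposition 𝓜] [SetLike.GradedSMul 𝒜 𝓜] in
theorem _root_.orbit_units_eq_iff {a b : R} :
    MulAction.orbit Rˣ a = MulAction.orbit Rˣ b ↔ Associated b a := by
  rw [MulAction.orbit_eq_iff]
  constructor
  · rintro ⟨u, hu⟩
    exact ⟨u, by rw [← hu]; change _ = (u : R) • b; rw [smul_eq_mul, mul_comm]⟩
  · rintro ⟨u, hu⟩
    exact ⟨u, by rw [← hu]; change (u : R) • b = _; rw [smul_eq_mul, mul_comm]⟩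

open Classical in
/-- The multiplicity of `(n, {0})` in the signature. -/
theorem eventually_count_signature_zero (ht : IsGradedUniformizer 𝒜 t d) (n : ℕ) :
    ∀ᶠ a in Filter.atTop,
      D.signature.count (n, MulAction.orbit Rˣ (0 : R)) = powLayerRank 𝒜 𝓜 t n a := by
  have := ht.isDomain
  -- A nonzero `f_j` is a unit times some `t ^ b`, so for large `a` only the zero divisors `f_j = 0`
  -- fail to divide `t ^ a`.
  have h : ∀ j, ∀ᶠ a in Filter.atTop, D.f j = 0 ∨ D.f j ∣ t ^ a := by
    intro j
    by_cases hj : D.f j = 0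
    · simp [hj]
    · obtain ⟨e, he⟩ := D.homogeneous j
      obtain ⟨c, -, hcu, b, -, h⟩ := ht.exists_eq e _ he hj
      filter_upwards [Filter.eventually_ge_atTop b] with a hab
      right
      rw [h, hcu.mul_left_dvd]
      exact pow_dvd_pow t hab
  filter_upwards [Filter.eventually_all.2 h] with a ha
  rw [← D.card_eq_powLayerRank ht, count_signature]
  congr 1
  refine Finset.filter_congr fun j _ => and_congr_right fun _ => ?_
  rw [orbit_units_eq_iff, Associated.comm, associated_zero_iff_eq_zero]
  constructor
  · intro h h'
    rw [h, zero_dvd_iff] at h'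
    exact pow_ne_zero a ht.ne_zero h'
  · exact (ha j).resolve_right

open Classical in
/-- The multiplicity of `(n, Rˣ t ^ (a + 1))` in the signature. -/
theorem count_signature_add (ht : IsGradedUniformizer 𝒜 t d) (n a : ℕ) :
    D.signature.count (n, MulAction.orbit Rˣ (t ^ (a + 1))) + powLayerRank 𝒜 𝓜 t n (a + 1) =
      powLayerRank 𝒜 𝓜 t n a := by
  have := ht.isDomain
  -- The `f_j` not dividing `t ^ a` are multiples of `t ^ (a + 1)`: either associated to it or not
  -- dividing it either.
  rw [← D.card_eq_powLayerRank ht, ← D.card_eq_powLayerRank ht, count_signature,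
    ← Finset.card_union_of_disjoint]
  · congr 1
    ext j
    simp only [Finset.mem_union, Finset.mem_filter, Finset.mem_univ, true_and, ← and_or_left,
      and_congr_right_iff, orbit_units_eq_iff]
    intro _
    constructor
    · rintro (h | h) h'
      · have h1 := h.dvd.trans h'
        rw [pow_dvd_pow_iff ht.ne_zero ht.not_isUnit] at h1
        omega
      · exact h (h'.trans (pow_dvd_pow t (Nat.le_succ a)))
    · intro h
      by_cases h' : D.f j ∣ t ^ (a + 1)
      · exact Or.inl (associated_of_dvd_dvd
          (ht.pow_dvd_of_not_dvd_pow (D.homogeneous j) h) h')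
      · exact Or.inr h'
  · rw [Finset.disjoint_filter]
    intro j _ h h'
    exact h'.2 (orbit_units_eq_iff.1 h.2).symm.dvd

/-- Only the orbits of `0` and of the powers `t ^ (a + 1)` can occur, and `powLayerRank` determines
the multiplicity of each. -/
theorem signature_eq (ht : IsGradedUniformizer 𝒜 t d)
    (D' : GradedElementaryDivisorDecomposition 𝒜 𝓜) : D.signature = D'.signature := by
  classical
  have := ht.isDomain
  have hform : ∀ (D : GradedElementaryDivisorDecomposition 𝒜 𝓜) (n : ℕ) (O : Set R),
      (n, O) ∈ D.signature → O = MulAction.orbit Rˣ (0 : R) ∨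
        ∃ a, O = MulAction.orbit Rˣ (t ^ (a + 1)) := by
    intro D n O h
    obtain ⟨j, -, hj⟩ := Multiset.mem_map.1 h
    obtain ⟨rfl, rfl⟩ := Prod.mk.inj hj
    by_cases h0 : D.f j = 0
    · exact Or.inl (by rw [h0])
    obtain ⟨e, he⟩ := D.homogeneous j
    obtain ⟨c, -, hcu, b, -, hf⟩ := ht.exists_eq e _ he h0
    -- Exponent `0` would make `f_j` a unit.
    cases b with
    | zero =>
      refine absurd ?_ (D.not_isUnit j)
      rwa [hf, pow_zero, mul_one]
    | succ a =>
      refine Or.inr ⟨a, orbit_units_eq_iff.2 ?_⟩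
      rw [hf]
      exact associated_unit_mul_right _ c hcu
  ext ⟨n, O⟩
  by_cases hO : (n, O) ∈ D.signature ∨ (n, O) ∈ D'.signature
  · rcases hO.elim (hform D n O) (hform D' n O) with rfl | ⟨a, rfl⟩
    · obtain ⟨a, h, h'⟩ := ((D.eventually_count_signature_zero ht n).and
        (D'.eventually_count_signature_zero ht n)).exists
      rw [h, h']
    · have h := D.count_signature_add ht n a
      have h' := D'.count_signature_add ht n a
      omega
  · rw [not_or] at hO
    rw [Multiset.count_eq_zero_of_notMem hO.1, Multiset.count_eq_zero_of_notMem hO.2]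

end GradedElementaryDivisorDecomposition

end Uniqueness

theorem theorem1 {R : Type*} [CommRing R] (𝒜 : ℕ → AddSubgroup R) [GradedRing 𝒜]
    (hR : IsGradedPID 𝒜) (hR₀ : 𝒜 0 ≠ ⊤)
    {M : Type*} [AddCommGroup M] [Module R M] [Module.Finite R M]
    (𝓜 : ℕ → AddSubgroup M) [DirectSum.Decomposition 𝓜] [SetLike.GradedSMul 𝒜 𝓜] :
    Nonempty (GradedElementaryDivisorDecomposition 𝒜 𝓜) ∧
      ∀ D D' : GradedElementaryDivisorDecomposition 𝒜 𝓜, D.signature = D'.signature := by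
  obtain ⟨t, d, ht⟩ := hR.exists_isGradedUniformizer hR₀
  exact ⟨ht.nonempty_decomposition, fun D D' => D.signature_eq ht D'⟩
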